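/- Let $\Omega\subset\mathbb C^2$ be open, let $\mathcal P_2$ be the ring of polynomials in two complex variables over $\mathbb C$, and let $\mathcal X\subset\operatorname{Hol}(\Omega)$ be a linear subspace equipped with a topology that makes it a Hausdorff topological vector space (not necessarily locally convex, metrizable or complete). Assume: (P1) $\mathcal P_2\subset\mathcal X$ (polynomials being restricted to $\Omega$), and $\mathcal P_2$ is dense in $\mathcal X$; (P2) for each $w\in\Omega$ the evaluation functional $F\mapsto F(w)$ is continuous on $\mathcal X$; (P3) for $j=1,2$, multiplication by the coordinate $z_j$ maps $\mathcal X$ into $\mathcal X$ and is continuous there. For $F\in\mathcal X$ let $S[F]=\overline{\{PF:P\in\mathcal P_2\}}$, the closure being taken in $\mathcal X$. Call $F$ cyclic if $S[F]=\mathcal X$, and call a family $\mathcal F\subset\mathcal X$ jointly cyclic if the closed linear span in $\mathcal X$ of $\bigcup_{F\in\mathcal F}S[F]$ is $\mathcal X$. Let $\Omega_{max}$ be the set of all $w\in\mathbb C^2$ for which the map $P\mapsto P(w)$ on $\mathcal P_2$ extends to a continuous linear functional on $\mathcal X$, i.e. there is a continuous linear functional $\Lambda$ on $\mathcal X$ with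 $\Lambda(P)=P(w)$ for all $P\in\mathcal P_2$. For an arbitrary (possibly infinite) family $\mathcal F\subset\mathcal P_2$ let $V(\mathcal F)=\{w\in\mathbb C^2: P(w)=0\text{ for all }P\in\mathcal F\}$, and let $\mathfrak g(\mathcal F)$ be a greatest common divisor of $\mathcal F$ in $\mathcal P_2$ (it exists and is unique up to a non-zero constant factor; it is $0$ if $\mathcal F\subset\{0\}$). Then $\mathcal F$ is jointly cyclic if and only if $V(\mathcal F)\cap\Omega_{max}=\emptyset$ and $\mathfrak g(\mathcal F)$ is cyclic. -/

import Mathlib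

noncomputable section

/-- The algebra of holomorphic functions on `Ω ⊆ ℂ^d`: functions `Ω → ℂ` that are the restriction of
a function which is complex differentiable on `Ω` (used for open `Ω` only). -/
def holSubalgebra {d : ℕ} (Ω : Set (Fin d → ℂ)) : Subalgebra ℂ (Ω → ℂ) where
  carrier := {f | ∃ g : (Fin d → ℂ) → ℂ, DifferentiableOn ℂ g Ω ∧ ∀ z : Ω, f z = g z}
  mul_mem' := by
    rintro f₁ f₂ ⟨g₁, h₁, e₁⟩ ⟨g₂, h₂, e₂⟩
    exact ⟨fun z => g₁ z * g₂ z, h₁.mul h₂, fun z => by simp [e₁, e₂]⟩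
  add_mem' := by
    rintro f₁ f₂ ⟨g₁, h₁, e₁⟩ ⟨g₂, h₂, e₂⟩
    exact ⟨fun z => g₁ z + g₂ z, h₁.add h₂, fun z => by simp [e₁, e₂]⟩
  algebraMap_mem' := fun c => ⟨fun _ => c, differentiableOn_const c, fun _ => rfl⟩

/-- `Hol(Ω)` as a type of its own. It deliberately carries no topology, so that a linear subspace
of it carries no topology other than the one it is explicitly given. -/
def Hol {d : ℕ} (Ω : Set (Fin d → ℂ)) : Type := ↥(holSubalgebra Ω)

namespace Hol

variable {d : ℕ} {Ω : Set (Fin d → ℂ)}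

instance instCommRing : CommRing (Hol Ω) := inferInstanceAs (CommRing ↥(holSubalgebra Ω))

instance instAlgebra : Algebra ℂ (Hol Ω) := inferInstanceAs (Algebra ℂ ↥(holSubalgebra Ω))

/-- An element of `Hol(Ω)` is used as a function on `Ω`. -/
instance instCoeFun : CoeFun (Hol Ω) (fun _ => Ω → ℂ) := ⟨fun f => f.1⟩

theorem ext {f g : Hol Ω} (h : ∀ z : Ω, f z = g z) : f = g := Subtype.ext (funext h)

theorem add_apply (f g : Hol Ω) (z : Ω) : (f + g) z = f z + g z := rfl

theorem smul_apply (c : ℂ) (f : Hol Ω) (z : Ω) : (c • f) z = c * f z := rfl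

theorem mul_apply (f g : Hol Ω) (z : Ω) : (f * g) z = f z * g z := rfl

end Hol

/-- A polynomial in `d` complex variables, as a holomorphic function on `Ω`. -/
def polyHol {d : ℕ} (Ω : Set (Fin d → ℂ)) (P : MvPolynomial (Fin d) ℂ) : Hol Ω :=
  ⟨fun z => MvPolynomial.eval (z : Fin d → ℂ) P, fun w => MvPolynomial.eval w P,
    (AnalyticOnNhd.eval_mvPolynomial (𝕜 := ℂ) P).differentiableOn.mono (Set.subset_univ Ω), fun _ => rfl⟩

theorem polyHol_apply {d : ℕ} (Ω : Set (Fin d → ℂ)) (P : MvPolynomial (Fin d) ℂ) (z : Ω) :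
    polyHol Ω P z = MvPolynomial.eval (z : Fin d → ℂ) P := rfl

/-- The standing hypotheses on a linear subspace `X ⊆ Hol(Ω)` with a topology: `X` contains the
polynomials and they are dense in `X`; evaluation at each point of `Ω` is a continuous functional
on `X`; multiplication by each coordinate function is a continuous operator from `X` to `X`. -/
structure IsShiftSpace {d : ℕ} {Ω : Set (Fin d → ℂ)} (X : Submodule ℂ (Hol Ω))
    [TopologicalSpace X] : Prop where
  poly_mem : ∀ P : MvPolynomial (Fin d) ℂ, polyHol Ω P ∈ X
  poly_dense : Dense {F : X | ∃ P : MvPolynomial (Fin d) ℂ, (F : Hol Ω) = polyHol Ω P}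
  continuous_eval : ∀ w : Ω, Continuous fun F : X => (F : Hol Ω) w
  continuous_shift : ∀ j : Fin d, ∃ S : X →L[ℂ] X,
    ∀ (F : X) (z : Ω), (S F : Hol Ω) z = (z : Fin d → ℂ) j * (F : Hol Ω) z

namespace IsShiftSpace

variable {d : ℕ} {Ω : Set (Fin d → ℂ)} {X : Submodule ℂ (Hol Ω)} [TopologicalSpace X]

/-- A polynomial as an element of `X`. -/
def poly (hX : IsShiftSpace X) (P : MvPolynomial (Fin d) ℂ) : X := ⟨polyHol Ω P, hX.poly_mem P⟩

/-- The maximal domain of `X`: the points `w` of `ℂ^d` for which `P ↦ P(w)` extends from the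
polynomials to a continuous linear functional on `X`. -/
def maximalDomain (hX : IsShiftSpace X) : Set (Fin d → ℂ) :=
  {w | ∃ Λ : X →L[ℂ] ℂ, ∀ P : MvPolynomial (Fin d) ℂ, Λ (hX.poly P) = MvPolynomial.eval w P}

end IsShiftSpace

section Cyclic

variable {d : ℕ} {Ω : Set (Fin d → ℂ)} {X : Submodule ℂ (Hol Ω)} [TopologicalSpace X]

/-- The invariant subspace `S[F]`: the closure in `X` of `{P F : P a polynomial}`. -/
def invariantSubspace (F : X) : Set X :=
  closure {G : X | ∃ P : MvPolynomial (Fin d) ℂ, (G : Hol Ω) = polyHol Ω P * (F : Hol Ω)}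

/-- `F` is cyclic if `S[F] = X`. -/
def IsCyclicVector (F : X) : Prop := invariantSubspace F = Set.univ

/-- A family `𝓕 ⊆ X` is jointly cyclic if the closed linear span in `X` of the subspaces `S[F]`,
`F ∈ 𝓕`, is `X`. -/
def IsJointlyCyclic (𝓕 : Set X) : Prop :=
  closure (Submodule.span ℂ (⋃ F ∈ 𝓕, invariantSubspace F) : Set X) = Set.univ

end Cyclic

/-- The common vanishing set `V(𝓕)` in `ℂ^d` of a family of polynomials. -/
def commonZeros {d : ℕ} (𝓕 : Set (MvPolynomial (Fin d) ℂ)) : Set (Fin d → ℂ) :=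
  {w | ∀ P ∈ 𝓕, MvPolynomial.eval w P = 0}

/-- `g` is a greatest common divisor of the (possibly infinite) family `𝓕`. -/
def IsGCDOfFamily {d : ℕ} (𝓕 : Set (MvPolynomial (Fin d) ℂ)) (g : MvPolynomial (Fin d) ℂ) : Prop :=
  (∀ P ∈ 𝓕, g ∣ P) ∧ ∀ h : MvPolynomial (Fin d) ℂ, (∀ P ∈ 𝓕, h ∣ P) → h ∣ g

/-- Every family of polynomials has a greatest common divisor. -/
theorem exists_isGCDOfFamily {d : ℕ} (𝓕 : Set (MvPolynomial (Fin d) ℂ)) :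
    ∃ g, IsGCDOfFamily 𝓕 g := by
  classical
  obtain ⟨_⟩ : Nonempty (NormalizedGCDMonoid (MvPolynomial (Fin d) ℂ)) := inferInstance
  obtain ⟨s, hs⟩ := (isNoetherianRing_iff_ideal_fg (MvPolynomial (Fin d) ℂ)).1 inferInstance
    (Ideal.span 𝓕)
  have key : ∀ h : MvPolynomial (Fin d) ℂ,
      (∀ P ∈ 𝓕, h ∣ P) ↔ ∀ P ∈ s, h ∣ P := by
    intro h
    have e : ∀ t : Set (MvPolynomial (Fin d) ℂ),
        (∀ P ∈ t, h ∣ P) ↔ Ideal.span t ≤ Ideal.span {h} := by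
      intro t
      rw [Ideal.span_le]
      exact forall₂_congr fun P _ => Ideal.mem_span_singleton.symm
    rw [e 𝓕, ← hs]
    exact (e (s : Set (MvPolynomial (Fin d) ℂ))).symm
  refine ⟨s.gcd id, (key _).2 fun P hP => Finset.gcd_dvd hP, fun h hh => ?_⟩
  exact Finset.dvd_gcd ((key h).1 hh)

end

/-! Let `I` be the ideal generated by `𝓕`; joint cyclicity says that `I` is dense. If so, the larger
ideal `(g)` is dense, and no continuous extension of a point evaluation can kill `I`, since it maps
1 to 1. Conversely, for `g ≠ 0` the ideal `J = {Q : Q g ∈ I}` has no non-unit common divisor, so in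
two variables it has finite codimension (`finite_quotient_of_forall_le_span_isUnit`). Hence the
multiples of `g` have finite-dimensional image in the Hausdorff quotient of `X` by the closure of
`I`. Cyclicity of `g` makes that image dense; it is also closed, so the quotient is
finite-dimensional. Were it non-zero, the Nullstellensatz would give a point `w` where all
polynomials in the closure of `I` vanish. Evaluation at `w` then factors through the quotient, where
linear functionals are continuous, so `w` is a common zero in the maximal domain. -/

/-- An ideal of `K[x, y]` without a non-constant common divisor has finite codimension. -/
theorem finite_quotient_of_forall_le_span_isUnit {K : Type*} [Field K]
    (J : Ideal (MvPolynomial (Fin 2) K))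
    (hJ : ∀ h : MvPolynomial (Fin 2) K, J ≤ Ideal.span {h} → IsUnit h) :
    Module.Finite K (MvPolynomial (Fin 2) K ⧸ J) := by
  have hdim : ringKrullDim (MvPolynomial (Fin 2) K) = 2 := by
    rw [MvPolynomial.ringKrullDim_of_isNoetherianRing, ringKrullDim_eq_zero_of_field]
    simp
  have hmax : ∀ P : Ideal (MvPolynomial (Fin 2) K), P.IsPrime → J ≤ P → P.IsMaximal := by
    intro P hP hJP
    by_contra hnm
    obtain ⟨M, hM, hPM⟩ := P.exists_le_maximal hP.ne_top
    have hPM' : P < M := lt_of_le_of_ne hPM fun h => hnm (h ▸ hM)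
    have hP0 : P ≠ ⊥ := by
      rintro rfl
      exact not_isUnit_zero (hJ 0 (hJP.trans bot_le))
    obtain ⟨p, hpP, hp⟩ := hP.exists_mem_prime_of_ne_bot hP0
    have hpr : (Ideal.span {p}).IsPrime := (Ideal.span_singleton_prime hp.ne_zero).2 hp
    have hle : Ideal.span {p} ≤ P := (Ideal.span_singleton_le_iff_mem _).2 hpP
    have hlt : Ideal.span {p} < P :=
      lt_of_le_of_ne hle fun h => hp.not_isUnit (hJ p (h ▸ hJP))
    have h0 : (⊥ : Ideal (MvPolynomial (Fin 2) K)) < Ideal.span {p} :=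
      bot_lt_iff_ne_bot.2 fun h => hp.ne_zero (Ideal.span_singleton_eq_bot.1 h)
    -- A non-maximal prime over `J` would give a chain of length 3, one more than the dimension
    -- allows.
    let s : LTSeries (PrimeSpectrum (MvPolynomial (Fin 2) K)) :=
      { length := 3
        toFun := ![⟨⊥, Ideal.isPrime_bot⟩, ⟨Ideal.span {p}, hpr⟩, ⟨P, hP⟩, ⟨M, hM.isPrime⟩]
        step := by
          intro i
          fin_cases i
          · exact h0
          · exact hlt
          · exact hPM' }
    have h3 : ((3 : ℕ) : WithBot ℕ∞) ≤ ringKrullDim (MvPolynomial (Fin 2) K) :=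
      Order.LTSeries.length_le_krullDim s
    rw [hdim] at h3
    exact absurd (Nat.cast_le.1 (h3 : ((3 : ℕ) : WithBot ℕ∞) ≤ ((2 : ℕ) : WithBot ℕ∞)))
      (by norm_num)
  have : Ring.KrullDimLE 0 (MvPolynomial (Fin 2) K ⧸ J) := by
    rw [Ring.krullDimLE_zero_iff]
    intro Q hQ
    have hc : (Q.comap (Ideal.Quotient.mk J)).IsMaximal :=
      hmax _ (Ideal.comap_isPrime _ _) fun x hx => by
        rw [Ideal.mem_comap, Ideal.Quotient.eq_zero_iff_mem.2 hx]
        exact Q.zero_mem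
    rw [← Ideal.map_comap_of_surjective _ Ideal.Quotient.mk_surjective Q]
    refine (Ideal.map_eq_top_or_isMaximal_of_surjective _ Ideal.Quotient.mk_surjective
      hc).resolve_left fun h => hQ.ne_top ?_
    rwa [Ideal.map_comap_of_surjective _ Ideal.Quotient.mk_surjective Q] at h
  -- Noetherian of dimension zero means Artinian; for an algebra of finite type over a field this
  -- forces finite dimension.
  have : IsArtinianRing (MvPolynomial (Fin 2) K ⧸ J) :=
    isArtinianRing_iff_krullDimLE_zero.2 this
  exact Module.finite_of_isArtinianRing K _

/-- A linear map with finite-dimensional range and dense range in a Hausdorff space. -/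
theorem LinearMap.finiteDimensional_of_denseRange {V E : Type*} [AddCommGroup V] [Module ℂ V]
    [AddCommGroup E] [Module ℂ E] [TopologicalSpace E] [IsTopologicalAddGroup E]
    [ContinuousSMul ℂ E] [T2Space E] (f : V →ₗ[ℂ] E) [FiniteDimensional ℂ (LinearMap.range f)]
    (hf : DenseRange f) : FiniteDimensional ℂ E := by
  have hcl : IsClosed (LinearMap.range f : Set E) := Submodule.closed_of_finiteDimensional _
  have htop : LinearMap.range f = ⊤ := by
    apply SetLike.coe_injective
    rw [← hcl.closure_eq, LinearMap.coe_range]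
    exact hf.closure_range
  have : FiniteDimensional ℂ (⊤ : Submodule ℂ E) := htop ▸ inferInstance
  exact Module.Finite.equiv (Submodule.topEquiv (R := ℂ) (M := E))

namespace IsShiftSpace

variable {d : ℕ} {Ω : Set (Fin d → ℂ)} {X : Submodule ℂ (Hol Ω)} [TopologicalSpace X]

theorem polyHol_mul (P Q : MvPolynomial (Fin d) ℂ) :
    polyHol Ω (P * Q) = polyHol Ω P * polyHol Ω Q :=
  Hol.ext fun z => by simp [polyHol_apply, Hol.mul_apply]

/-- `IsShiftSpace.poly` as a linear map. -/
noncomputable def polyLinear (hX : IsShiftSpace X) : MvPolynomial (Fin d) ℂ →ₗ[ℂ] X where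
  toFun := hX.poly
  map_add' P Q := Subtype.ext <| Hol.ext fun z => MvPolynomial.eval (z : Fin d → ℂ) |>.map_add P Q
  map_smul' c P := Subtype.ext <| Hol.ext fun z => MvPolynomial.smul_eval (z : Fin d → ℂ) P c

theorem polyLinear_apply (hX : IsShiftSpace X) (P : MvPolynomial (Fin d) ℂ) :
    hX.polyLinear P = hX.poly P := rfl

theorem denseRange_poly (hX : IsShiftSpace X) : DenseRange hX.poly := by
  refine hX.poly_dense.mono ?_
  rintro F ⟨P, hP⟩
  exact ⟨P, Subtype.ext hP.symm⟩

theorem invariantSubspace_poly (hX : IsShiftSpace X) (P : MvPolynomial (Fin d) ℂ) :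
    invariantSubspace (hX.poly P) = closure (Set.range fun Q => hX.poly (Q * P)) := by
  unfold invariantSubspace
  congr 1
  ext G
  constructor
  · rintro ⟨Q, hQ⟩
    exact ⟨Q, Subtype.ext ((polyHol_mul Q P).trans hQ.symm)⟩
  · rintro ⟨Q, rfl⟩
    exact ⟨Q, polyHol_mul Q P⟩

/-- Multiplication by a coordinate maps `hX.poly P` to `hX.poly (X j * P)`. -/
theorem exists_shift (hX : IsShiftSpace X) (j : Fin d) :
    ∃ S : X →L[ℂ] X, ∀ P, S (hX.poly P) = hX.poly (MvPolynomial.X j * P) := by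
  obtain ⟨S, hS⟩ := hX.continuous_shift j
  refine ⟨S, fun P => Subtype.ext <| Hol.ext fun z => (hS _ z).trans ?_⟩
  change _ * MvPolynomial.eval _ _ = MvPolynomial.eval _ _
  simp

/-- Multiplication by a polynomial, on polynomials, extends to a continuous operator. -/
theorem exists_mul (hX : IsShiftSpace X) [IsTopologicalAddGroup X] [ContinuousSMul ℂ X]
    (Q : MvPolynomial (Fin d) ℂ) :
    ∃ S : X →L[ℂ] X, ∀ P, S (hX.poly P) = hX.poly (Q * P) := by
  induction Q using MvPolynomial.induction_on with
  | C a =>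
    refine ⟨a • ContinuousLinearMap.id ℂ X, fun P => ?_⟩
    rw [← MvPolynomial.smul_eq_C_mul]
    exact (hX.polyLinear.map_smul a P).symm
  | add p q hp hq =>
    obtain ⟨S, hS⟩ := hp
    obtain ⟨T, hT⟩ := hq
    refine ⟨S + T, fun P => ?_⟩
    rw [add_mul, add_apply, hS, hT]
    exact (hX.polyLinear.map_add _ _).symm
  | mul_X p j hp =>
    obtain ⟨S, hS⟩ := hp
    obtain ⟨T, hT⟩ := hX.exists_shift j
    refine ⟨S.comp T, fun P => ?_⟩
    rw [ContinuousLinearMap.comp_apply, hT, hS, mul_assoc]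

/-! ### Closures of polynomial ideals in `X`. -/

variable [IsTopologicalAddGroup X] [ContinuousSMul ℂ X]

/-- The closure in `X` of an ideal of polynomials. -/
noncomputable def idealClosure (hX : IsShiftSpace X) (I : Ideal (MvPolynomial (Fin d) ℂ)) : Submodule ℂ X :=
  ((I.restrictScalars ℂ).map hX.polyLinear).topologicalClosure

theorem isClosed_idealClosure (hX : IsShiftSpace X) (I : Ideal (MvPolynomial (Fin d) ℂ)) :
    IsClosed (hX.idealClosure I : Set X) :=
  Submodule.isClosed_topologicalClosure _

theorem poly_mem_idealClosure (hX : IsShiftSpace X) {I : Ideal (MvPolynomial (Fin d) ℂ)}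
    {P : MvPolynomial (Fin d) ℂ} (hP : P ∈ I) : hX.poly P ∈ hX.idealClosure I :=
  Submodule.le_topologicalClosure _ ⟨P, hP, rfl⟩

theorem idealClosure_le (hX : IsShiftSpace X) {I : Ideal (MvPolynomial (Fin d) ℂ)}
    {N : Submodule ℂ X} (hN : IsClosed (N : Set X)) (h : ∀ P ∈ I, hX.poly P ∈ N) :
    hX.idealClosure I ≤ N := by
  refine Submodule.topologicalClosure_minimal _ ?_ hN
  rintro _ ⟨P, hP, rfl⟩
  exact h P hP

theorem idealClosure_mono (hX : IsShiftSpace X) {I J : Ideal (MvPolynomial (Fin d) ℂ)}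
    (h : I ≤ J) : hX.idealClosure I ≤ hX.idealClosure J :=
  hX.idealClosure_le (hX.isClosed_idealClosure J) fun _ hP => hX.poly_mem_idealClosure (h hP)

theorem idealClosure_eq_top_of_poly_mem (hX : IsShiftSpace X)
    {I : Ideal (MvPolynomial (Fin d) ℂ)} (h : ∀ P, hX.poly P ∈ hX.idealClosure I) :
    hX.idealClosure I = ⊤ :=
  eq_top_iff.2 fun F _ => (hX.isClosed_idealClosure I).closure_subset_iff.2
    (Set.range_subset_iff.2 h) (hX.denseRange_poly F)

theorem idealClosure_span_singleton (hX : IsShiftSpace X) (P : MvPolynomial (Fin d) ℂ) :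
    (hX.idealClosure (Ideal.span {P}) : Set X) = invariantSubspace (hX.poly P) := by
  rw [invariantSubspace_poly, idealClosure, Submodule.topologicalClosure_coe]
  congr 1
  ext G
  constructor
  · rintro ⟨Q, hQ, rfl⟩
    obtain ⟨R, rfl⟩ := Ideal.mem_span_singleton'.1 hQ
    exact ⟨R, rfl⟩
  · rintro ⟨Q, rfl⟩
    exact ⟨Q * P, Ideal.mem_span_singleton'.2 ⟨Q, rfl⟩, rfl⟩

theorem isCyclicVector_poly_iff (hX : IsShiftSpace X) (P : MvPolynomial (Fin d) ℂ) :
    IsCyclicVector (hX.poly P) ↔ hX.idealClosure (Ideal.span {P}) = ⊤ := by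
  rw [IsCyclicVector, ← idealClosure_span_singleton, ← Submodule.top_coe (R := ℂ),
    SetLike.coe_set_eq]

/-- The span of the subspaces `S[F]` lies between the image of the ideal and its closure. -/
theorem isJointlyCyclic_poly_iff (hX : IsShiftSpace X) (𝓕 : Set (MvPolynomial (Fin d) ℂ)) :
    IsJointlyCyclic (hX.poly '' 𝓕) ↔ hX.idealClosure (Ideal.span 𝓕) = ⊤ := by
  set N : Submodule ℂ X := Submodule.span ℂ (⋃ F ∈ hX.poly '' 𝓕, invariantSubspace F) with hN
  have key : N.topologicalClosure = hX.idealClosure (Ideal.span 𝓕) := by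
    apply le_antisymm
    · refine Submodule.topologicalClosure_minimal _ ?_ (hX.isClosed_idealClosure _)
      refine Submodule.span_le.2 (Set.iUnion₂_subset ?_)
      rintro _ ⟨P, hP, rfl⟩
      rw [← idealClosure_span_singleton]
      exact hX.idealClosure_mono
        ((Ideal.span_singleton_le_iff_mem _).2 (Ideal.subset_span hP))
    · refine hX.idealClosure_le (Submodule.isClosed_topologicalClosure _) fun P hP => ?_
      refine Submodule.le_topologicalClosure _ ?_
      -- `N` is only known to be a linear subspace; quantifying over multipliers `Q` lets the `smul`
      -- case absorb the ideal coefficient.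
      suffices ∀ Q, hX.polyLinear (Q * P) ∈ N by
        rw [← polyLinear_apply, ← one_mul P]
        exact this 1
      induction hP using Submodule.span_induction with
      | zero => simp
      | add p q _ _ hp hq =>
        intro Q
        rw [mul_add, map_add]
        exact N.add_mem (hp Q) (hq Q)
      | mem p hp =>
        intro Q
        refine Submodule.subset_span (Set.mem_iUnion₂.2 ⟨_, ⟨p, hp, rfl⟩, ?_⟩)
        rw [← idealClosure_span_singleton]
        exact hX.poly_mem_idealClosure (Ideal.mem_span_singleton'.2 ⟨Q, rfl⟩)
      | smul a p _ ih =>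
        intro Q
        rw [smul_eq_mul, ← mul_assoc]
        exact ih (Q * a)
  rw [IsJointlyCyclic, ← key, ← Submodule.topologicalClosure_coe, ← Submodule.top_coe (R := ℂ),
    SetLike.coe_set_eq]

/-- The ideal of polynomials whose image lies in the closure of `I`. -/
noncomputable def closedIdeal (hX : IsShiftSpace X) (I : Ideal (MvPolynomial (Fin d) ℂ)) :
    Ideal (MvPolynomial (Fin d) ℂ) where
  carrier := {P | hX.poly P ∈ hX.idealClosure I}
  add_mem' {P Q} hP hQ := by
    change hX.polyLinear (P + Q) ∈ hX.idealClosure I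
    rw [map_add]
    exact add_mem hP hQ
  zero_mem' := by
    change hX.polyLinear 0 ∈ hX.idealClosure I
    rw [map_zero]
    exact zero_mem _
  smul_mem' Q P hP := by
    obtain ⟨S, hS⟩ := hX.exists_mul Q
    change hX.poly (Q * P) ∈ hX.idealClosure I
    rw [← hS]
    have hle : hX.idealClosure I ≤ (hX.idealClosure I).comap S.toLinearMap := by
      refine hX.idealClosure_le ((hX.isClosed_idealClosure I).preimage S.continuous) fun R hR => ?_
      change S (hX.poly R) ∈ hX.idealClosure I
      rw [hS]
      exact hX.poly_mem_idealClosure (I.mul_mem_left Q hR)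
    exact hle hP

theorem mem_closedIdeal (hX : IsShiftSpace X) {I : Ideal (MvPolynomial (Fin d) ℂ)}
    {P : MvPolynomial (Fin d) ℂ} : P ∈ hX.closedIdeal I ↔ hX.poly P ∈ hX.idealClosure I :=
  Iff.rfl

/-! ### Finite codimension and the maximal domain. -/

/-- A point evaluation is continuous on `X` if it annihilates an ideal whose closure has finite
codimension. -/
theorem mem_maximalDomain_of_finiteDimensional (hX : IsShiftSpace X)
    (I : Ideal (MvPolynomial (Fin d) ℂ)) [FiniteDimensional ℂ (X ⧸ hX.idealClosure I)]
    {w : Fin d → ℂ} (hw : ∀ P ∈ hX.closedIdeal I, MvPolynomial.eval w P = 0) :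
    w ∈ hX.maximalDomain := by
  -- Closedness makes the quotient Hausdorff, so `l` below is automatically continuous.
  have hcl := hX.isClosed_idealClosure I
  let π : X →L[ℂ] X ⧸ hX.idealClosure I := (hX.idealClosure I).mkQL
  let φ : MvPolynomial (Fin d) ℂ →ₗ[ℂ] X ⧸ hX.idealClosure I :=
    (hX.idealClosure I).mkQ.comp hX.polyLinear
  have hker : LinearMap.ker φ ≤ LinearMap.ker (MvPolynomial.aeval w).toLinearMap := by
    intro P hP
    exact hw P ((Submodule.Quotient.mk_eq_zero (hX.idealClosure I)).1 hP)
  obtain ⟨l, hl⟩ := LinearMap.exists_extend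
    ((LinearMap.ker φ).liftQ (MvPolynomial.aeval w).toLinearMap hker ∘ₗ
      φ.quotKerEquivRange.symm.toLinearMap)
  refine ⟨l.toContinuousLinearMap.comp π, fun P => ?_⟩
  have hP : φ P ∈ LinearMap.range φ := LinearMap.mem_range_self φ P
  exact (LinearMap.congr_fun hl ⟨φ P, hP⟩).trans
    (congrArg ((LinearMap.ker φ).liftQ (MvPolynomial.aeval w).toLinearMap hker)
      (φ.quotKerEquivRange_symm_apply_image P hP))

/-- If `g` is cyclic, `{Q : g Q ∈ I}` has finite codimension, and `I` has no common zero in the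
maximal domain, then `I` is dense. -/
theorem idealClosure_eq_top_of_finite (hX : IsShiftSpace X)
    (I : Ideal (MvPolynomial (Fin d) ℂ)) (g : MvPolynomial (Fin d) ℂ)
    (hfin : FiniteDimensional ℂ (LinearMap.range
      ((hX.idealClosure I).mkQ ∘ₗ hX.polyLinear ∘ₗ LinearMap.mulRight ℂ g)))
    (hg : IsCyclicVector (hX.poly g))
    (hI : ∀ w ∈ hX.maximalDomain, ∃ P ∈ I, MvPolynomial.eval w P ≠ 0) :
    hX.idealClosure I = ⊤ := by
  have hcl := hX.isClosed_idealClosure I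
  have hdense : DenseRange (hX.polyLinear ∘ₗ LinearMap.mulRight ℂ g) := by
    rw [IsCyclicVector, invariantSubspace_poly] at hg
    exact dense_iff_closure_eq.2 hg
  have : FiniteDimensional ℂ (X ⧸ hX.idealClosure I) :=
    LinearMap.finiteDimensional_of_denseRange
      ((hX.idealClosure I).mkQ ∘ₗ hX.polyLinear ∘ₗ LinearMap.mulRight ℂ g)
      ((hX.idealClosure I).mkQ_surjective.denseRange.comp hdense
        (hX.idealClosure I).mkQL.continuous)
  refine hX.idealClosure_eq_top_of_poly_mem fun P => ?_
  rw [← mem_closedIdeal]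
  by_contra hP
  obtain ⟨m, hm, hle⟩ := (hX.closedIdeal I).exists_le_maximal fun h => hP (h ▸ Submodule.mem_top)
  obtain ⟨w, rfl⟩ := (MvPolynomial.isMaximal_iff_eq_vanishingIdeal_singleton).1 hm
  have hw : ∀ P ∈ hX.closedIdeal I, MvPolynomial.eval w P = 0 := fun P hP => by
    simpa using (MvPolynomial.mem_vanishingIdeal_singleton_iff w P).1 (hle hP)
  obtain ⟨Q, hQ, hne⟩ := hI w (hX.mem_maximalDomain_of_finiteDimensional I hw)
  exact hne (hw Q (hX.poly_mem_idealClosure hQ))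

end IsShiftSpace

theorem corollary3p7 {Ω : Set (Fin 2 → ℂ)} (hΩ : IsOpen Ω) (X : Submodule ℂ (Hol Ω))
    [TopologicalSpace X] [IsTopologicalAddGroup X] [ContinuousSMul ℂ X] [T2Space X]
    (hX : IsShiftSpace X) (𝓕 : Set (MvPolynomial (Fin 2) ℂ))
    (g : MvPolynomial (Fin 2) ℂ) (hg : IsGCDOfFamily 𝓕 g) :
    IsJointlyCyclic (hX.poly '' 𝓕) ↔
      commonZeros 𝓕 ∩ hX.maximalDomain = ∅ ∧ IsCyclicVector (hX.poly g) := by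
  rw [hX.isJointlyCyclic_poly_iff]
  have hle : Ideal.span 𝓕 ≤ Ideal.span {g} :=
    Ideal.span_le.2 fun P hP => Ideal.mem_span_singleton.2 (hg.1 P hP)
  constructor
  · intro h
    refine ⟨Set.eq_empty_iff_forall_notMem.2 ?_,
      (hX.isCyclicVector_poly_iff g).2 (top_le_iff.1 (h ▸ hX.idealClosure_mono hle))⟩
    rintro w ⟨hw, Λ, hΛ⟩
    have hspan : Ideal.span 𝓕 ≤ RingHom.ker (MvPolynomial.eval w) := Ideal.span_le.2 hw
    have hker : hX.idealClosure (Ideal.span 𝓕) ≤ LinearMap.ker Λ.toLinearMap :=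
      hX.idealClosure_le Λ.isClosed_ker fun P hP => (hΛ P).trans (hspan hP)
    have h1 : Λ (hX.poly 1) = 0 := hker (h ▸ Submodule.mem_top)
    rw [hΛ, map_one] at h1
    exact one_ne_zero h1
  · rintro ⟨hV, hcyc⟩
    refine hX.idealClosure_eq_top_of_finite _ g ?_ hcyc fun w hw => ?_
    · set φ := (hX.idealClosure (Ideal.span 𝓕)).mkQ ∘ₗ hX.polyLinear ∘ₗ LinearMap.mulRight ℂ g
        with hφ
      -- Cancelling `g` below needs `g ≠ 0`.
      by_cases hg0 : g = 0
      · have : φ = 0 := LinearMap.ext fun Q => by simp [hφ, hg0]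
        rw [this, LinearMap.range_zero]
        infer_instance
      let J : Ideal (MvPolynomial (Fin 2) ℂ) :=
        Submodule.comap (LinearMap.mulRight (MvPolynomial (Fin 2) ℂ) g) (Ideal.span 𝓕)
      have : Module.Finite ℂ (MvPolynomial (Fin 2) ℂ ⧸ J) := by
        refine finite_quotient_of_forall_le_span_isUnit J fun h hh => ?_
        -- Each `P` in `𝓕` is `g Q` with `Q ∈ J`, so a common divisor `h` of `J` makes `h g` a
        -- common divisor of `𝓕`.
        have hd : h * g ∣ g := hg.2 _ fun P hP => by
          obtain ⟨Q, rfl⟩ := hg.1 P hP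
          have hQ : Q ∈ J := by
            change Q * g ∈ Ideal.span 𝓕
            rw [mul_comm]
            exact Ideal.subset_span hP
          rw [mul_comm g]
          exact mul_dvd_mul_right (Ideal.mem_span_singleton.1 (hh hQ)) g
        obtain ⟨c, hc⟩ := hd
        refine IsUnit.of_mul_eq_one c (mul_right_cancel₀ hg0 ?_)
        linear_combination -hc
      have hker : J.restrictScalars ℂ ≤ LinearMap.ker φ := fun Q hQ =>
        by
        have hQ' : Q * g ∈ Ideal.span 𝓕 := hQ
        exact (Submodule.Quotient.mk_eq_zero _).2 (hX.poly_mem_idealClosure hQ')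
      rw [← Submodule.range_liftQ (J.restrictScalars ℂ) φ hker]
      have : Module.Finite ℂ (MvPolynomial (Fin 2) ℂ ⧸ J.restrictScalars ℂ) := this
      infer_instance
    · by_contra! hw'
      exact Set.eq_empty_iff_forall_notMem.1 hV w
        ⟨fun P hP => hw' P (Ideal.subset_span hP), hw⟩
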